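/- Let $k$ be a field and $q\in k^{\times}$. Let $H_q$ be the $k$-algebra generated by $D_1,D_2,\sigma^{\pm1}$ subject to $D_1D_2=D_2D_1$, $\sigma\sigma^{-1}=\sigma^{-1}\sigma=1$, $q\sigma D_i=D_i\sigma$ ($i=1,2$) and, if $q$ is a primitive $l$-th root of unity with $l\ge 2$, also $D_1^l=D_2^l=0$. It is a bialgebra (in fact a Hopf algebra) with $\Delta(D_1)=D_1\otimes\sigma+1\otimes D_1$, $\Delta(D_2)=D_2\otimes 1+\sigma\otimes D_2$, $\Delta(\sigma)=\sigma\otimes\sigma$, $\epsilon(D_i)=0$, $\epsilon(\sigma)=1$. Let $G$ be a group acting linearly on a finite dimensional $k$-vector space $V$, let $f\colon G\times G\to k^{\times}$ be a normal $2$-cocycle (for the trivial action), and let $A=S(V)\#_fG$ be the crossed product: the free left $S(V)$-module with basis $\{w_g:g\in G\}$ and product $(Pw_g)(Qw_h)=P\,{}^gQ\,f(g,h)\,w_{gh}$. We regard $V\subseteq S(V)\subseteq A$ via $P\mapsto Pw_1$. A left transposition of $H_q$ on $A$ is a bijective $k$-linear map $s\colon H_q\otimes A\to A\otimes H_q$ that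 is compatible with the unit, multiplication, counit and comultiplication of $H_q$, with the flip $\tau$ of $H_q\otimes H_q$ (that is, $(s\otimes H_q)(H_q\otimes s)(\tau\otimes A)=(A\otimes\tau)(s\otimes H_q)(H_q\otimes s)$), and with the unit and multiplication of $A$. It is good if $(s\otimes H_q)(H_q\otimes s)(D_1\otimes D_2\otimes a)=a\otimes D_1\otimes D_2$ for all $a\in A$. An $H_q$-module algebra structure on $(A,s)$ is a left $H_q$-module structure $\rho\colon H_q\otimes A\to A$, $h\otimes a\mapsto h\cdot a$, such that $s(H_q\otimes\rho)=(\rho\otimes H_q)(H_q\otimes s)(\tau\otimes A)$, $\;\rho(H_q\otimes\mu_A)=\mu_A(\rho\otimes\rho)(H_q\otimes s\otimes A)(\Delta\otimes A\otimes A)$ and $h\cdot 1=\epsilon(h)1$ for all $h\in H_q$. Let $\hat\alpha\colon V\to V$ be a bijective $k[G]$-linear map, $\chi_\alpha\colon G\to k^{\times}$ a group homomorphism, and $s$ the good transposition of $H_q$ on $A$ with $s(D_1\otimes v)=\hat\alpha(v)\otimes D_1$ and $s(D_1\otimes w_g)=\chi_\alpha(g)w_g\otimes D_1$ for all $v\in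 V$, $g\in G$. Let $\hat\delta_1,\hat\delta_2\colon V\to A$ and $\hat\varsigma\colon V\to V$ be $k$-linear maps and $\chi_\varsigma\colon G\to k^{\times}$ a map. Assume that $\ker\hat\delta_1$ and $\ker\hat\delta_2$ have codimension $1$ in $V$, that $\ker\hat\delta_1\neq\ker\hat\delta_2$, and that for $i=1,2$ there are $x_i\in V\setminus\ker\hat\delta_i$, $P_i\in S(V)$ and $g_i\in G$ with $\hat\delta_i(x_i)=P_iw_{g_i}$. For $g\in G$ let $\lambda_{ig}\in k$ be the element with ${}^gx_i-\lambda_{ig}x_i\in\ker\hat\delta_i$. Suppose that there is an $H_q$-module algebra structure on $(A,s)$ such that $$\sigma\cdot v=\hat\varsigma(v),\quad \sigma\cdot w_g=\chi_\varsigma(g)w_g,\quad D_i\cdot v=\hat\delta_i(v),\quad D_i\cdot w_g=0$$ for all $v\in V$, $g\in G$, $i\in\{1,2\}$, and that $P_1\in S(\ker\hat\delta_1)$ and $P_2\in S(\ker\hat\delta_2)$. Then $$\lambda_{1g_1}\lambda_{1g_2}=q,\qquad \lambda_{2g_1}\lambda_{2g_2}=q^{-1},$$ and $g_1g_2$ acts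 on $V$ with determinant $1$. -/

import Mathlib

open scoped TensorProduct

noncomputable section

/-! ## Braided module algebras over an ordinary bialgebra

Throughout, the braid of the bialgebra `H` is the flip. -/

namespace Braided

variable {k H A : Type*} [Field k] [Ring H] [Bialgebra k H]

section Space

variable [AddCommGroup A] [Module k A]

/-- For `s : H ⊗ A → A ⊗ H`, the composite
`(s ⊗ H) ∘ (H ⊗ s) : H ⊗ H ⊗ A → A ⊗ H ⊗ H`. -/
def slideLeft (s : H ⊗[k] A →ₗ[k] A ⊗[k] H) :
    H ⊗[k] (H ⊗[k] A) →ₗ[k] (A ⊗[k] H) ⊗[k] H :=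
  s.rTensor H ∘ₗ (TensorProduct.assoc k H A H).symm.toLinearMap ∘ₗ s.lTensor H

/-- `(A, s)` is a left `H`-braided space: `s` is bijective, compatible with the unit, the
multiplication, the counit and the comultiplication of `H`, and with the braid (the flip)
of `H`. -/
structure IsBraidedSpace (s : H ⊗[k] A →ₗ[k] A ⊗[k] H) : Prop where
  bijective : Function.Bijective s
  one_tmul : ∀ a : A, s (1 ⊗ₜ a) = a ⊗ₜ 1
  mul_tmul : ∀ (h l : H) (a : A),
    s ((h * l) ⊗ₜ a) =
      ((LinearMap.mul' k H).lTensor A)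
        (TensorProduct.assoc k A H H (slideLeft s (h ⊗ₜ (l ⊗ₜ a))))
  counit_comp : ∀ (h : H) (a : A),
    TensorProduct.rid k A ((Coalgebra.counit (R := k) (A := H)).lTensor A (s (h ⊗ₜ a))) =
      Coalgebra.counit (R := k) h • a
  comul_comp : ∀ (h : H) (a : A),
    (Coalgebra.comul (R := k) (A := H)).lTensor A (s (h ⊗ₜ a)) =
      TensorProduct.assoc k A H H
        (slideLeft s (TensorProduct.assoc k H H A (Coalgebra.comul (R := k) h ⊗ₜ a)))
  braid_comp : ∀ (h l : H) (a : A),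
    TensorProduct.assoc k A H H (slideLeft s (l ⊗ₜ (h ⊗ₜ a))) =
      ((TensorProduct.comm k H H).toLinearMap.lTensor A)
        (TensorProduct.assoc k A H H (slideLeft s (h ⊗ₜ (l ⊗ₜ a))))

end Space

variable [Ring A] [Algebra k A]

/-- `s : H ⊗ A → A ⊗ H` is a left transposition of `H` on the algebra `A`: `(A, s)` is a left
`H`-braided space and `s` is compatible with the algebra structure of `A`. -/
structure IsLeftTransposition (s : H ⊗[k] A →ₗ[k] A ⊗[k] H) : Prop
    extends IsBraidedSpace s where
  tmul_one : ∀ h : H, s (h ⊗ₜ 1) = 1 ⊗ₜ h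
  tmul_mul : ∀ (h : H) (a b : A),
    s (h ⊗ₜ (a * b)) =
      ((LinearMap.mul' k A).rTensor H)
        ((TensorProduct.assoc k A A H).symm
          (s.lTensor A (TensorProduct.assoc k A H A (s (h ⊗ₜ a) ⊗ₜ b))))

/-- For an action `act : H ⊗ A → A`, the map
`μ_A ∘ (act ⊗ act) ∘ (H ⊗ s ⊗ A) : (H ⊗ H) ⊗ (A ⊗ A) → A`. -/
def diagonalAct (s : H ⊗[k] A →ₗ[k] A ⊗[k] H) (act : H ⊗[k] A →ₗ[k] A) :
    (H ⊗[k] H) ⊗[k] (A ⊗[k] A) →ₗ[k] A :=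
  LinearMap.mul' k A ∘ₗ TensorProduct.map act act ∘ₗ
    (TensorProduct.assoc k H A (H ⊗[k] A)).symm.toLinearMap ∘ₗ
    ((TensorProduct.assoc k A H A).toLinearMap ∘ₗ s.rTensor A ∘ₗ
      (TensorProduct.assoc k H A A).symm.toLinearMap).lTensor H ∘ₗ
    (TensorProduct.assoc k H H (A ⊗[k] A)).toLinearMap

/-- `(A, s)` is a left `H`-module algebra via the action `act : H ⊗ A → A`: `s` is a left
transposition, `act` is a left `H`-module structure compatible with `s` (for the flip as braid of
`H`), and the multiplication and the unit of `A` are morphisms of left `H`-modules. -/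
structure IsModuleAlgebra (s : H ⊗[k] A →ₗ[k] A ⊗[k] H) (act : H ⊗[k] A →ₗ[k] A) : Prop
    extends IsLeftTransposition s where
  one_act : ∀ a : A, act (1 ⊗ₜ a) = a
  mul_act : ∀ (h l : H) (a : A), act ((h * l) ⊗ₜ a) = act (h ⊗ₜ act (l ⊗ₜ a))
  transpose_act : ∀ (h l : H) (a : A),
    s (h ⊗ₜ act (l ⊗ₜ a)) =
      act.rTensor H ((TensorProduct.assoc k H A H).symm (s.lTensor H (l ⊗ₜ (h ⊗ₜ a))))
  act_mul : ∀ (h : H) (a b : A),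
    act (h ⊗ₜ (a * b)) = diagonalAct s act (Coalgebra.comul (R := k) h ⊗ₜ (a ⊗ₜ b))
  act_one : ∀ h : H, act (h ⊗ₜ 1) = algebraMap k A (Coalgebra.counit (R := k) h)

end Braided

/-! ## The bialgebra `H_q` -/

namespace Hq

/-- Names for the generators `D₁, D₂, σ, σ⁻¹`. -/
inductive Gen : Type
  | D₁ | D₂ | σ | σinv

variable {k : Type*} [Field k]

/-- Shorthand for a generator of the free algebra. -/
abbrev gen (k : Type*) [Field k] (x : Gen) : FreeAlgebra k Gen := FreeAlgebra.ι k x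

/-- The defining relations; the relations `D₁ˡ = D₂ˡ = 0` are present exactly when `q` is a
primitive `l`-th root of unity with `l ≥ 2`. -/
inductive Rel (q : kˣ) : FreeAlgebra k Gen → FreeAlgebra k Gen → Prop
  | D₁_D₂ : Rel q (gen k .D₁ * gen k .D₂) (gen k .D₂ * gen k .D₁)
  | σ_σinv : Rel q (gen k .σ * gen k .σinv) 1
  | σinv_σ : Rel q (gen k .σinv * gen k .σ) 1
  | σ_D₁ : Rel q ((q : k) • (gen k .σ * gen k .D₁)) (gen k .D₁ * gen k .σ)
  | σ_D₂ : Rel q ((q : k) • (gen k .σ * gen k .D₂)) (gen k .D₂ * gen k .σ)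
  | D₁_pow (l : ℕ) (hl : 2 ≤ l) (hq : IsPrimitiveRoot q l) : Rel q (gen k .D₁ ^ l) 0
  | D₂_pow (l : ℕ) (hl : 2 ≤ l) (hq : IsPrimitiveRoot q l) : Rel q (gen k .D₂ ^ l) 0

end Hq

/-- The algebra `H_q`. -/
def Hq {k : Type*} [Field k] (q : kˣ) : Type _ := RingQuot (Hq.Rel q)

namespace Hq

variable {k : Type*} [Field k] (q : kˣ)

instance : Ring (Hq q) := inferInstanceAs (Ring (RingQuot (Hq.Rel q)))
instance : Algebra k (Hq q) := inferInstanceAs (Algebra k (RingQuot (Hq.Rel q)))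

/-- The quotient map from the free algebra. -/
def mk : FreeAlgebra k Gen →ₐ[k] Hq q := RingQuot.mkAlgHom k (Rel q)

/-- The generator `D₁` of `H_q`. -/
def D₁ : Hq q := mk q (gen k .D₁)
/-- The generator `D₂` of `H_q`. -/
def D₂ : Hq q := mk q (gen k .D₂)
/-- The generator `σ` of `H_q`. -/
def σ : Hq q := mk q (gen k .σ)
/-- The generator `σ⁻¹` of `H_q`. -/
def σinv : Hq q := mk q (gen k .σinv)

theorem mk_rel {x y : FreeAlgebra k Gen} (h : Rel q x y) : mk q x = mk q y :=
  RingQuot.mkAlgHom_rel k h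

theorem D₁_mul_D₂ : D₁ q * D₂ q = D₂ q * D₁ q := by
  simpa [D₁, D₂] using mk_rel q .D₁_D₂
theorem σ_mul_σinv : σ q * σinv q = 1 := by simpa [σ, σinv] using mk_rel q .σ_σinv
theorem σinv_mul_σ : σinv q * σ q = 1 := by simpa [σ, σinv] using mk_rel q .σinv_σ
theorem D₁_mul_σ : D₁ q * σ q = (q : k) • (σ q * D₁ q) := by
  simpa [D₁, σ] using (mk_rel q .σ_D₁).symm
theorem D₂_mul_σ : D₂ q * σ q = (q : k) • (σ q * D₂ q) := by
  simpa [D₂, σ] using (mk_rel q .σ_D₂).symm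
theorem D₁_pow {l : ℕ} (hl : 2 ≤ l) (hq : IsPrimitiveRoot q l) : D₁ q ^ l = 0 := by
  simpa [D₁] using mk_rel q (.D₁_pow l hl hq)
theorem D₂_pow {l : ℕ} (hl : 2 ≤ l) (hq : IsPrimitiveRoot q l) : D₂ q ^ l = 0 := by
  simpa [D₂] using mk_rel q (.D₂_pow l hl hq)

section Lift

variable {B : Type*} [Ring B] [Algebra k B]

/-- Algebra maps out of `H_q` are given by images of the generators satisfying the relations. -/
def lift (φ : Gen → B)
    (h : ∀ ⦃x y⦄, Rel q x y → FreeAlgebra.lift k φ x = FreeAlgebra.lift k φ y) : Hq q →ₐ[k] B :=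
  RingQuot.liftAlgHom k ⟨FreeAlgebra.lift k φ, h⟩

theorem lift_mk (φ : Gen → B) (h) (x : FreeAlgebra k Gen) :
    lift q φ h (mk q x) = FreeAlgebra.lift k φ x :=
  RingQuot.liftAlgHom_mkAlgHom_apply k _ h x

theorem algHom_ext {F F' : Hq q →ₐ[k] B} (h₁ : F (D₁ q) = F' (D₁ q)) (h₂ : F (D₂ q) = F' (D₂ q))
    (h₃ : F (σ q) = F' (σ q)) (h₄ : F (σinv q) = F' (σinv q)) : F = F' := by
  apply RingQuot.ringQuot_ext'
  apply FreeAlgebra.hom_ext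
  funext x
  cases x
  exacts [h₁, h₂, h₃, h₄]

end Lift

/-! ### A `q`-binomial computation, needed for the comultiplication -/

/-- Gaussian binomial coefficients. -/
def gauss (t : k) : ℕ → ℕ → k
  | _, 0 => 1
  | 0, _ + 1 => 0
  | n + 1, j + 1 => gauss t n j + t ^ (j + 1) * gauss t n (j + 1)

theorem gauss_zero_right (t : k) (n : ℕ) : gauss t n 0 = 1 := by cases n <;> rfl

theorem gauss_eq_zero (t : k) : ∀ (n j : ℕ), n < j → gauss t n j = 0
  | _, 0, h => absurd h (by omega)
  | 0, _ + 1, _ => rfl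
  | n + 1, j + 1, h => by
    rw [gauss, gauss_eq_zero t n j (by omega), gauss_eq_zero t n (j + 1) (by omega)]; simp

theorem gauss_self (t : k) : ∀ n : ℕ, gauss t n n = 1
  | 0 => rfl
  | n + 1 => by rw [gauss, gauss_self t n, gauss_eq_zero t n (n + 1) (by omega)]; simp

theorem gauss_absorb (t : k) : ∀ n j : ℕ,
    (t ^ (j + 1) - 1) * gauss t (n + 1) (j + 1) = (t ^ (n + 1) - 1) * gauss t n j
  | 0, 0 => by simp [gauss]
  | 0, j + 1 => by simp [gauss]
  | n + 1, 0 => by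
    have h := gauss_absorb t n 0
    have e : gauss t (n + 1 + 1) (0 + 1) =
      gauss t (n + 1) 0 + t ^ (0 + 1) * gauss t (n + 1) (0 + 1) := rfl
    rw [e, gauss_zero_right]
    rw [gauss_zero_right] at h
    linear_combination t ^ (0 + 1) * h
  | n + 1, j + 1 => by
    have h := gauss_absorb t n (j + 1)
    have h' := gauss_absorb t n j
    rw [gauss]
    have e : gauss t (n + 1) (j + 1) = gauss t n j + t ^ (j + 1) * gauss t n (j + 1) := rfl
    linear_combination t ^ (j + 2) * h + t * h' - t * (t ^ (n + 1) - 1) * e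

theorem add_pow_expand {B : Type*} [Ring B] [Algebra k B] (t : k) (X Y : B)
    (h : Y * X = t • (X * Y)) (n : ℕ) :
    (X + Y) ^ n = ∑ j ∈ Finset.range (n + 1), gauss t n j • (X ^ j * Y ^ (n - j)) := by
  have hj : ∀ j : ℕ, Y * X ^ j = t ^ j • (X ^ j * Y) := by
    intro j
    induction j with
    | zero => simp
    | succ j ih =>
      rw [pow_succ, ← mul_assoc, ih, smul_mul_assoc, mul_assoc, h, mul_smul_comm, smul_smul,
        ← pow_succ, mul_assoc]
  induction n with
  | zero => simp [gauss]
  | succ n ih =>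
    rw [pow_succ', ih, add_mul, Finset.mul_sum, Finset.mul_sum]
    have e1 : ∑ j ∈ Finset.range (n + 1), X * gauss t n j • (X ^ j * Y ^ (n - j)) =
        ∑ j ∈ Finset.range (n + 1), gauss t n j • (X ^ (j + 1) * Y ^ (n - j)) :=
      Finset.sum_congr rfl fun j _ => by rw [mul_smul_comm, ← mul_assoc, ← pow_succ']
    have e2 : ∑ j ∈ Finset.range (n + 1), Y * gauss t n j • (X ^ j * Y ^ (n - j)) =
        ∑ j ∈ Finset.range (n + 2), (t ^ j * gauss t n j) • (X ^ j * Y ^ (n + 1 - j)) := by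
      rw [Finset.sum_range_succ _ (n + 1), gauss_eq_zero t n (n + 1) (by omega)]
      simp only [mul_zero, zero_smul, add_zero]
      refine Finset.sum_congr rfl fun j hjn => ?_
      have : n + 1 - j = (n - j) + 1 := by have := Finset.mem_range.1 hjn; omega
      rw [mul_smul_comm, ← mul_assoc, hj, smul_mul_assoc, smul_smul, mul_assoc, ← pow_succ', this,
        mul_comm]
    rw [e1, e2, Finset.sum_range_succ' _ (n + 1), Finset.sum_range_succ' _ (n + 1), ← add_assoc,
      ← Finset.sum_add_distrib]
    congr 1
    · refine Finset.sum_congr rfl fun j _ => ?_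
      rw [gauss, add_smul, Nat.add_sub_add_right]
    · simp [gauss_zero_right]

theorem add_pow_primitiveRoot {B : Type*} [Ring B] [Algebra k B] {l : ℕ} (hl : 2 ≤ l)
    (hq : IsPrimitiveRoot q l) (X Y : B) (h : Y * X = (q : k) • (X * Y)) :
    (X + Y) ^ l = X ^ l + Y ^ l := by
  obtain ⟨n, rfl⟩ : ∃ n, l = n + 1 := ⟨l - 1, by omega⟩
  rw [add_pow_expand (q : k) X Y h, Finset.sum_range_succ, Finset.sum_range_succ',
    Finset.sum_eq_zero, gauss_self, gauss_zero_right]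
  · simp [add_comm]
  · intro j hj
    have hj := Finset.mem_range.1 hj
    have h1 : ((q : k) ^ (n + 1) - 1) = 0 := by
      have := hq.pow_eq_one
      rw [sub_eq_zero, ← Units.val_pow_eq_pow_val, this, Units.val_one]
    have h2 : ((q : k) ^ (j + 1) - 1) ≠ 0 := by
      intro h0
      rw [sub_eq_zero] at h0
      rw [← Units.val_pow_eq_pow_val] at h0
      exact hq.pow_ne_one_of_pos_of_lt (by omega) (by omega) (Units.val_eq_one.1 h0)
    have h3 := gauss_absorb (q : k) n j
    rw [h1, zero_mul] at h3
    rw [(mul_eq_zero.1 h3).resolve_left h2, zero_smul]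

/-! ### The coalgebra structure -/

/-- The comultiplication: `Δ D₁ = D₁ ⊗ σ + 1 ⊗ D₁`, `Δ D₂ = D₂ ⊗ 1 + σ ⊗ D₂`,
`Δ σ^{±1} = σ^{±1} ⊗ σ^{±1}`. -/
def comulGen : Gen → Hq q ⊗[k] Hq q
  | .D₁ => D₁ q ⊗ₜ σ q + 1 ⊗ₜ D₁ q
  | .D₂ => D₂ q ⊗ₜ 1 + σ q ⊗ₜ D₂ q
  | .σ => σ q ⊗ₜ σ q
  | .σinv => σinv q ⊗ₜ σinv q

/-- The counit on generators. -/
def counitGen : Gen → k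
  | .D₁ => 0
  | .D₂ => 0
  | .σ => 1
  | .σinv => 1

/-- The comultiplication of `H_q`. -/
def comulHom : Hq q →ₐ[k] Hq q ⊗[k] Hq q := lift q (comulGen q) <| by
  intro x y h
  induction h with
  | D₁_D₂ =>
    simp only [map_mul, FreeAlgebra.lift_ι_apply, comulGen, add_mul, mul_add,
      Algebra.TensorProduct.tmul_mul_tmul, one_mul, mul_one, D₁_mul_D₂, D₁_mul_σ, D₂_mul_σ,
      TensorProduct.smul_tmul', TensorProduct.tmul_smul]
    abel
  | σ_σinv => simp [comulGen, σ_mul_σinv, Algebra.TensorProduct.one_def]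
  | σinv_σ => simp [comulGen, σinv_mul_σ, Algebra.TensorProduct.one_def]
  | σ_D₁ => simp [comulGen, D₁_mul_σ, mul_add, add_mul, TensorProduct.smul_tmul']
  | σ_D₂ => simp [comulGen, D₂_mul_σ, mul_add, add_mul, TensorProduct.smul_tmul']
  | D₁_pow l hl hq =>
    simp only [map_pow, FreeAlgebra.lift_ι_apply, comulGen, map_zero]
    rw [add_pow_primitiveRoot q hl hq]
    · simp [Algebra.TensorProduct.tmul_pow, D₁_pow q hl hq]
    · simp [D₁_mul_σ]
  | D₂_pow l hl hq =>
    simp only [map_pow, FreeAlgebra.lift_ι_apply, comulGen, map_zero]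
    rw [add_comm, add_pow_primitiveRoot q hl hq]
    · simp [Algebra.TensorProduct.tmul_pow, D₂_pow q hl hq]
    · simp [D₂_mul_σ, TensorProduct.smul_tmul']

/-- The counit of `H_q`. -/
def counitHom : Hq q →ₐ[k] k := lift q counitGen <| by
  intro x y h
  induction h with
  | D₁_pow l hl hq =>
    simp [counitGen, show l ≠ 0 by omega]
  | D₂_pow l hl hq =>
    simp [counitGen, show l ≠ 0 by omega]
  | _ => simp [counitGen]

theorem comulHom_D₁ : comulHom q (D₁ q) = D₁ q ⊗ₜ σ q + 1 ⊗ₜ D₁ q := by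
  simp [comulHom, D₁, lift_mk, comulGen]
theorem comulHom_D₂ : comulHom q (D₂ q) = D₂ q ⊗ₜ 1 + σ q ⊗ₜ D₂ q := by
  simp [comulHom, D₂, lift_mk, comulGen]
theorem comulHom_σ : comulHom q (σ q) = σ q ⊗ₜ σ q := by
  simp [comulHom, σ, lift_mk, comulGen]
theorem comulHom_σinv : comulHom q (σinv q) = σinv q ⊗ₜ σinv q := by
  simp [comulHom, σinv, lift_mk, comulGen]
theorem counitHom_D₁ : counitHom q (D₁ q) = 0 := by simp [counitHom, D₁, lift_mk, counitGen]
theorem counitHom_D₂ : counitHom q (D₂ q) = 0 := by simp [counitHom, D₂, lift_mk, counitGen]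
theorem counitHom_σ : counitHom q (σ q) = 1 := by simp [counitHom, σ, lift_mk, counitGen]
theorem counitHom_σinv : counitHom q (σinv q) = 1 := by
  simp [counitHom, σinv, lift_mk, counitGen]

instance : Bialgebra k (Hq q) :=
  Bialgebra.ofAlgHom (comulHom q) (counitHom q)
    (by
      apply algHom_ext <;>
        simp [comulHom_D₁, comulHom_D₂, comulHom_σ, comulHom_σinv, TensorProduct.add_tmul,
          TensorProduct.tmul_add, Algebra.TensorProduct.one_def, add_assoc])
    (by
      apply algHom_ext <;>
        simp [comulHom_D₁, comulHom_D₂, comulHom_σ, comulHom_σinv, counitHom_D₁, counitHom_D₂,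
          counitHom_σ, counitHom_σinv])
    (by
      apply algHom_ext <;>
        simp [comulHom_D₁, comulHom_D₂, comulHom_σ, comulHom_σinv, counitHom_D₁, counitHom_D₂,
          counitHom_σ, counitHom_σinv])

/-- A `k`-linear map `s : H_q ⊗ A → A ⊗ H_q` is good if
`(s ⊗ H_q) ∘ (H_q ⊗ s) (D₁ ⊗ D₂ ⊗ a) = a ⊗ D₁ ⊗ D₂` for all `a`. -/
def IsGood {A : Type*} [AddCommGroup A] [Module k A]
    (s : Hq q ⊗[k] A →ₗ[k] A ⊗[k] Hq q) : Prop :=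
  ∀ a : A, Braided.slideLeft s (D₁ q ⊗ₜ (D₂ q ⊗ₜ a)) = (a ⊗ₜ D₁ q) ⊗ₜ D₂ q

end Hq

/-! ## The crossed product `S(V) #_f G` -/

/-- A normal (normalized) 2-cocycle of `G` with values in `kˣ` (with trivial action). -/
structure NormalCocycle (k G : Type*) [Field k] [Group G] where
  /-- the underlying function -/
  toFun : G → G → kˣ
  one_left : ∀ g, toFun 1 g = 1
  one_right : ∀ g, toFun g 1 = 1
  cocycle : ∀ g h l, toFun g h * toFun (g * h) l = toFun h l * toFun g (h * l)

section CrossedProduct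

variable {k G V : Type*} [Field k] [Group G] [AddCommGroup V] [Module k V]

/-- The action of `g ∈ G` on `S(V)` by the algebra map extending the action on `V`. -/
def symAct (π : Representation k G V) (g : G) :
    SymmetricAlgebra k V →ₐ[k] SymmetricAlgebra k V :=
  SymmetricAlgebra.lift (SymmetricAlgebra.ι k V ∘ₗ π g)

theorem symAct_one (π : Representation k G V) (P : SymmetricAlgebra k V) :
    symAct π 1 P = P := by
  have : symAct π 1 = AlgHom.id k _ := by
    apply SymmetricAlgebra.algHom_ext
    ext v
    simp [symAct]
  rw [this]; rfl

theorem symAct_mul (π : Representation k G V) (g h : G) (P : SymmetricAlgebra k V) :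
    symAct π (g * h) P = symAct π g (symAct π h P) := by
  have : symAct π (g * h) = (symAct π g).comp (symAct π h) := by
    apply SymmetricAlgebra.algHom_ext
    ext v
    simp [symAct]
  rw [this]; rfl

/-- The crossed product `S(V) #_f G`: the free left `S(V)`-module on `{w_g : g ∈ G}`, with the
product `(P w_g) (Q w_h) = f(g, h) P ᵍQ w_{gh}`. -/
def CrossedProduct (_π : Representation k G V) (_f : NormalCocycle k G) : Type _ :=
  G →₀ SymmetricAlgebra k V

namespace CrossedProduct

variable (π : Representation k G V) (f : NormalCocycle k G)

instance : AddCommGroup (CrossedProduct π f) :=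
  inferInstanceAs (AddCommGroup (G →₀ SymmetricAlgebra k V))
instance : Module k (CrossedProduct π f) :=
  inferInstanceAs (Module k (G →₀ SymmetricAlgebra k V))

/-- The map `P ↦ P w_g`. -/
def monomial (g : G) : SymmetricAlgebra k V →ₗ[k] CrossedProduct π f :=
  Finsupp.lsingle (R := k) g

variable {π f}

@[elab_as_elim]
theorem induction_on {p : CrossedProduct π f → Prop} (a : CrossedProduct π f) (zero : p 0)
    (add : ∀ a b, p a → p b → p (a + b)) (single : ∀ g P, p (monomial π f g P)) : p a :=
  Finsupp.induction_linear (motive := p) a zero add single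

/-- The linear map out of the crossed product with given values on the `P w_g`. -/
def sumLift {M : Type*} [AddCommGroup M] [Module k M] (F : G → SymmetricAlgebra k V →ₗ[k] M) :
    CrossedProduct π f →ₗ[k] M :=
  Finsupp.lsum k F

theorem sumLift_monomial {M : Type*} [AddCommGroup M] [Module k M]
    (F : G → SymmetricAlgebra k V →ₗ[k] M) (g : G) (P : SymmetricAlgebra k V) :
    sumLift F (monomial π f g P) = F g P :=
  Finsupp.lsum_single k F g P

variable (π f)

/-- The multiplication as a bilinear map. -/
def mulBilin :
    CrossedProduct π f →ₗ[k] CrossedProduct π f →ₗ[k] CrossedProduct π f :=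
  sumLift fun g => LinearMap.flip <| sumLift fun h => LinearMap.flip <|
    ((LinearMap.mul k (SymmetricAlgebra k V)).compl₂ (symAct π g).toLinearMap).compr₂
      ((f.toFun g h : k) • monomial π f (g * h))

theorem mulBilin_monomial (g h : G) (P Q : SymmetricAlgebra k V) :
    mulBilin π f (monomial π f g P) (monomial π f h Q) =
      (f.toFun g h : k) • monomial π f (g * h) (P * symAct π g Q) := by
  rw [mulBilin, sumLift_monomial, LinearMap.flip_apply, sumLift_monomial]
  rfl

instance : Mul (CrossedProduct π f) := ⟨fun a b => mulBilin π f a b⟩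
instance : One (CrossedProduct π f) := ⟨monomial π f 1 1⟩

theorem mul_def (a b : CrossedProduct π f) : a * b = mulBilin π f a b := rfl
theorem one_def : (1 : CrossedProduct π f) = monomial π f 1 1 := rfl

theorem monomial_mul_monomial (g h : G) (P Q : SymmetricAlgebra k V) :
    monomial π f g P * monomial π f h Q =
      (f.toFun g h : k) • monomial π f (g * h) (P * symAct π g Q) :=
  mulBilin_monomial π f g h P Q

instance : Ring (CrossedProduct π f) where
  __ := (inferInstance : AddCommGroup (CrossedProduct π f))
  left_distrib a b c := by simp [mul_def]
  right_distrib a b c := by simp [mul_def]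
  zero_mul a := by simp [mul_def]
  mul_zero a := by simp [mul_def]
  one_mul a := by
    rw [mul_def, one_def]
    induction a using induction_on with
    | zero => simp
    | add a b ha hb => rw [map_add, ha, hb]
    | single g P => simp [mulBilin_monomial, f.one_left, symAct_one]
  mul_one a := by
    rw [mul_def, one_def]
    induction a using induction_on with
    | zero => simp
    | add a b ha hb => rw [map_add, LinearMap.add_apply, ha, hb]
    | single g P => simp [mulBilin_monomial, f.one_right]
  mul_assoc a b c := by
    simp only [mul_def]
    induction a using induction_on with
    | zero => simp
    | add a b ha hb => simp only [map_add, LinearMap.add_apply, ha, hb]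
    | single g P =>
    induction b using induction_on with
    | zero => simp
    | add a b ha hb => simp only [map_add, LinearMap.add_apply, ha, hb]
    | single h Q =>
    induction c using induction_on with
    | zero => simp
    | add a b ha hb => simp only [map_add, ha, hb]
    | single l R =>
      simp only [mulBilin_monomial, map_smul, LinearMap.smul_apply, smul_smul, map_mul,
        ← symAct_mul, ← mul_assoc]
      congr 1
      exact_mod_cast f.cocycle g h l

instance : Algebra k (CrossedProduct π f) :=
  Algebra.ofModule
    (fun r a b => by simp only [mul_def, map_smul, LinearMap.smul_apply])
    (fun r a b => by simp only [mul_def, map_smul])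

/-- The basis element `w_g`. -/
def w (g : G) : CrossedProduct π f := monomial π f g 1

/-- The inclusion `V ⊆ S(V) ⊆ S(V) #_f G`, `v ↦ v w_1`. -/
def ofV : V →ₗ[k] CrossedProduct π f := monomial π f 1 ∘ₗ SymmetricAlgebra.ι k V

end CrossedProduct

/-- For a subspace `U` of `V`, the symmetric algebra `S(U)` as a subalgebra of `S(V)`: the image of
the algebra map `S(U) → S(V)` induced by the inclusion. -/
def symSub (U : Submodule k V) : Subalgebra k (SymmetricAlgebra k V) :=
  (SymmetricAlgebra.lift (SymmetricAlgebra.ι k V ∘ₗ U.subtype)).range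

end CrossedProduct

end

open scoped TensorProduct

noncomputable section

/-! Compatibility of `s` with the unit and multiplication of the crossed product turns `s(D₁ ⊗ a)`
into `α'(a) ⊗ D₁` for an algebra endomorphism `α'`. Compatibility with `Δ(D₁)` then forces `s(σ ⊗ a)
= a ⊗ σ`, and goodness forces `s(D₂ ⊗ α'(a)) = a ⊗ D₂`. Hence `σ` acts by an algebra endomorphism
`S`, the operator `D₁` satisfies a Leibniz rule twisted by `(S, α')`, and `D₂ ∘ α'` satisfies one
twisted by `(α', S)`. Both have rank one on `V`, so a single study of such skew derivations serves
twice, with the two twists exchanged (`IsRankOneDerivation`).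

Let `E` be one of them, with twists extending `t₁`, `t₂`, and with `E v = φ(v) P w_g`. Applying `E`
to `xu = ux` with `φ(u) = 0` gives `g t₁ = t₂` on `ker φ` (`act_eq_of_apply_eq_zero`); applying it
to `w_h v = (hv) w_h` shows that `ker φ` is `G`-stable. Since `P` lies in `S(ker φ)`, the map `g t₁`
acts on `P` as `t₂` does, and comparing the scalars by which `t₁`, `t₂` and `g` multiply `P` yields
`eigenvalue_mul`.

For the two derivations this gives `g₁ς = α` on `ker φ₁` and `g₂α = ς` on `ker φ₂`, together with
two scalar identities in which `q` enters through `D_i σ = q σ D_i`. Evaluated on vectors dual to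
`φ₁, φ₂`, they give the two products of eigenvalues. Moreover `g₁g₂` fixes `ker φ₁ ∩ ker φ₂`
pointwise, so its determinant is the product of its eigenvalues on `φ₁` and `φ₂`, namely `q q⁻¹ =
1`. -/

theorem TensorProduct.tmul_right_injective_of_ne_zero {k M N : Type*} [Field k] [AddCommGroup M]
    [Module k M] [AddCommGroup N] [Module k N] {n : N} (hn : n ≠ 0) :
    Function.Injective ((TensorProduct.mk k M N).flip n) := by
  obtain ⟨ψ, hψ⟩ := Module.Projective.exists_dual_eq_one k hn
  intro a b hab
  simpa [hψ] using congrArg (fun t => TensorProduct.rid k M (ψ.lTensor M t)) hab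

theorem TensorProduct.tmul_left_injective_of_ne_zero {k M N : Type*} [Field k] [AddCommGroup M]
    [Module k M] [AddCommGroup N] [Module k N] {m : M} (hm : m ≠ 0) :
    Function.Injective (TensorProduct.mk k M N m) := by
  obtain ⟨ψ, hψ⟩ := Module.Projective.exists_dual_eq_one k hm
  intro a b hab
  simpa [hψ] using congrArg (fun t => TensorProduct.lid k N (ψ.rTensor N t)) hab

/-- The linear endomorphism `a ↦ h · a` of `A` given by `act : H ⊗ A → A`. -/
def Braided.actBy {k H A : Type*} [Field k] [AddCommGroup H] [Module k H] [AddCommGroup A]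
    [Module k A] (act : H ⊗[k] A →ₗ[k] A) (h : H) : A →ₗ[k] A :=
  act ∘ₗ TensorProduct.mk k H A h

/-! ### The transposition on the generators of `H_q` and the twisted Leibniz rules -/

namespace Hq

variable {k : Type*} [Field k] {q : kˣ}

theorem comul_D₁ : Coalgebra.comul (R := k) (D₁ q) = D₁ q ⊗ₜ[k] σ q + 1 ⊗ₜ D₁ q := comulHom_D₁ q
theorem comul_D₂ : Coalgebra.comul (R := k) (D₂ q) = D₂ q ⊗ₜ[k] 1 + σ q ⊗ₜ D₂ q := comulHom_D₂ q
theorem comul_σ : Coalgebra.comul (R := k) (σ q) = σ q ⊗ₜ[k] σ q := comulHom_σ q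
theorem counit_σ : Coalgebra.counit (R := k) (σ q) = 1 := counitHom_σ q

section Slide

variable {A : Type*} [AddCommGroup A] [Module k A] {s : Hq q ⊗[k] A →ₗ[k] A ⊗[k] Hq q}
  {α : A →ₗ[k] A}

theorem slideLeft_D₁ (hα : ∀ a, s (D₁ q ⊗ₜ a) = α a ⊗ₜ D₁ q) (l : Hq q) (a : A) :
    Braided.slideLeft s (D₁ q ⊗ₜ (l ⊗ₜ a)) =
      ((TensorProduct.mk k A (Hq q)).flip (D₁ q) ∘ₗ α).rTensor (Hq q) (s (l ⊗ₜ a)) := by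
  have : ∀ t : A ⊗[k] Hq q,
      s.rTensor (Hq q) ((TensorProduct.assoc k (Hq q) A (Hq q)).symm (D₁ q ⊗ₜ t)) =
      ((TensorProduct.mk k A (Hq q)).flip (D₁ q) ∘ₗ α).rTensor (Hq q) t := by
    intro t
    induction t with
    | zero => simp
    | add x y hx hy => simp only [TensorProduct.tmul_add, map_add, hx, hy]
    | tmul b l => simp [hα]
  simpa [Braided.slideLeft] using this (s (l ⊗ₜ a))

/-- Follows from bijectivity of `s` and `D₁ ≠ 0`. Tensoring with `H_q` over a field keeps
injectivity, so values of `s` can be identified after sliding `D₁` across them. -/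
theorem braid_D₁_injective (hs : Braided.IsBraidedSpace s) (hD : D₁ q ≠ 0)
    (hα : ∀ a, s (D₁ q ⊗ₜ a) = α a ⊗ₜ D₁ q) :
    Function.Injective ((TensorProduct.mk k A (Hq q)).flip (D₁ q) ∘ₗ α) := by
  intro a b hab
  refine TensorProduct.tmul_left_injective_of_ne_zero (k := k) hD (hs.bijective.1 ?_)
  simpa [hα] using hab

theorem braid_D₁_rTensor_injective (hs : Braided.IsBraidedSpace s) (hD : D₁ q ≠ 0)
    (hα : ∀ a, s (D₁ q ⊗ₜ a) = α a ⊗ₜ D₁ q) :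
    Function.Injective
      (((TensorProduct.mk k A (Hq q)).flip (D₁ q) ∘ₗ α).rTensor (Hq q)) :=
  Module.Flat.rTensor_preserves_injective_linearMap _ (braid_D₁_injective hs hD hα)

theorem braid_D₂ (hs : Braided.IsBraidedSpace s) (hgood : IsGood q s) (hD : D₁ q ≠ 0)
    (hα : ∀ a, s (D₁ q ⊗ₜ a) = α a ⊗ₜ D₁ q) (a : A) : s (D₂ q ⊗ₜ α a) = a ⊗ₜ D₂ q := by
  apply braid_D₁_rTensor_injective hs hD hα
  rw [← slideLeft_D₁ hα, hgood]
  simp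

/-- In the compatibility of `s` with `Δ(D₁) = D₁ ⊗ σ + 1 ⊗ D₁`, the terms from `1 ⊗ D₁` cancel. What
remains determines `s` on `σ`, once `D₁` is cancelled by injectivity. -/
theorem braid_σ (hs : Braided.IsBraidedSpace s) (hD : D₁ q ≠ 0)
    (hα : ∀ a, s (D₁ q ⊗ₜ a) = α a ⊗ₜ D₁ q) (a : A) : s (σ q ⊗ₜ a) = a ⊗ₜ σ q := by
  apply braid_D₁_rTensor_injective hs hD hα
  rw [← slideLeft_D₁ hα]
  apply (TensorProduct.assoc k A (Hq q) (Hq q)).injective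
  have h := hs.comul_comp (D₁ q) a
  have h1 : Braided.slideLeft s (1 ⊗ₜ (D₁ q ⊗ₜ a)) = (α a ⊗ₜ 1) ⊗ₜ D₁ q := by
    simp [Braided.slideLeft, hα, hs.one_tmul]
  rw [hα, LinearMap.lTensor_tmul, comul_D₁, TensorProduct.add_tmul, map_add, map_add, map_add,
    TensorProduct.tmul_add, TensorProduct.assoc_tmul, TensorProduct.assoc_tmul, h1,
    TensorProduct.assoc_tmul] at h
  simpa using (add_right_cancel h).symm

end Slide

section Algebra

variable {A : Type*} [Ring A] [Algebra k A] {s : Hq q ⊗[k] A →ₗ[k] A ⊗[k] Hq q}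

theorem braid_D₁_mul (hs : Braided.IsLeftTransposition s) {a b a' b' : A}
    (ha : s (D₁ q ⊗ₜ a) = a' ⊗ₜ D₁ q) (hb : s (D₁ q ⊗ₜ b) = b' ⊗ₜ D₁ q) :
    s (D₁ q ⊗ₜ (a * b)) = (a' * b') ⊗ₜ D₁ q := by
  rw [hs.tmul_mul, ha]
  simp [hb]

theorem exists_braid_D₁_algHom (hs : Braided.IsLeftTransposition s) (hD : D₁ q ≠ 0)
    (h : ∀ a, ∃ b, s (D₁ q ⊗ₜ a) = b ⊗ₜ D₁ q) :
    ∃ α : A →ₐ[k] A, ∀ a, s (D₁ q ⊗ₜ a) = α a ⊗ₜ D₁ q := by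
  choose α hα using h
  have inj := TensorProduct.tmul_right_injective_of_ne_zero (k := k) (M := A) hD
  have hadd : ∀ a b, α (a + b) = α a + α b := fun a b => inj <| by
    simp [← hα, TensorProduct.tmul_add]
  have hsmul : ∀ (r : k) a, α (r • a) = r • α a := fun r a => inj <| by
    have : (r • α a) ⊗ₜ[k] D₁ q = r • (α a ⊗ₜ[k] D₁ q) := rfl
    simp only [LinearMap.flip_apply, TensorProduct.mk_apply]
    rw [this, ← hα, ← hα, TensorProduct.tmul_smul, map_smul]
  refine ⟨AlgHom.ofLinearMap ⟨⟨α, hadd⟩, hsmul⟩ (inj ?_) fun a b => inj ?_, fun a => hα a⟩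
  · simpa using (hα 1).symm.trans (hs.tmul_one _)
  · simpa using (hα _).symm.trans (braid_D₁_mul hs (hα a) (hα b))

open Braided

variable {act : Hq q ⊗[k] A →ₗ[k] A} {α : A →ₐ[k] A}

theorem act_σ_mul (h : IsModuleAlgebra s act) (hσ : ∀ a, s (σ q ⊗ₜ a) = a ⊗ₜ σ q) (a b : A) :
    actBy act (σ q) (a * b) = actBy act (σ q) a * actBy act (σ q) b := by
  simp [actBy, h.act_mul, comul_σ, diagonalAct, hσ]

theorem act_D₁_mul (h : IsModuleAlgebra s act) (hα : ∀ a, s (D₁ q ⊗ₜ a) = α a ⊗ₜ D₁ q)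
    (hσ : ∀ a, s (σ q ⊗ₜ a) = a ⊗ₜ σ q) (a b : A) :
    actBy act (D₁ q) (a * b) =
      actBy act (D₁ q) a * actBy act (σ q) b + α a * actBy act (D₁ q) b := by
  simp [actBy, h.act_mul, comul_D₁, diagonalAct, hα, hσ, TensorProduct.add_tmul, h.one_act]

/-- The first factor is taken in the image of `α` because that is where `hα` gives the value of `s`
on `D₂`. Read as a rule for `D₂ ∘ α`, this is the `D₁` rule with `α` and `σ` exchanged. -/
theorem act_D₂_mul (h : IsModuleAlgebra s act) (hα : ∀ a, s (D₂ q ⊗ₜ α a) = a ⊗ₜ D₂ q)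
    (a b : A) : actBy act (D₂ q) (α a * b) =
      actBy act (D₂ q) (α a) * b + actBy act (σ q) a * actBy act (D₂ q) b := by
  simp [actBy, h.act_mul, comul_D₂, diagonalAct, hα, TensorProduct.add_tmul, h.one_act,
    h.one_tmul]

/-- Moving `D₁` past `l · a` applies `α` after `l`; by `transpose_act` the same tensor arises by
moving `D₁` past `a` first and then letting `l` act. -/
theorem act_commute (h : IsModuleAlgebra s act) (hD : D₁ q ≠ 0)
    (hα : ∀ a, s (D₁ q ⊗ₜ a) = α a ⊗ₜ D₁ q) (l : Hq q) (a : A) :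
    α (actBy act l a) = actBy act l (α a) := by
  apply TensorProduct.tmul_right_injective_of_ne_zero (k := k) hD
  have := h.transpose_act (D₁ q) l a
  simp [hα] at this
  simpa [actBy] using this

theorem act_σ_D₁ (h : IsModuleAlgebra s act) (a : A) :
    actBy act (D₁ q) (actBy act (σ q) a) = (q : k) • actBy act (σ q) (actBy act (D₁ q) a) := by
  have : ((q : k) • (σ q * D₁ q)) ⊗ₜ[k] a = (q : k) • ((σ q * D₁ q) ⊗ₜ[k] a) := rfl
  simp only [actBy, LinearMap.comp_apply, TensorProduct.mk_apply, ← h.mul_act, D₁_mul_σ]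
  rw [this, map_smul]

theorem act_σ_D₂ (h : IsModuleAlgebra s act) (a : A) :
    actBy act (D₂ q) (actBy act (σ q) a) = (q : k) • actBy act (σ q) (actBy act (D₂ q) a) := by
  have : ((q : k) • (σ q * D₂ q)) ⊗ₜ[k] a = (q : k) • ((σ q * D₂ q) ⊗ₜ[k] a) := rfl
  simp only [actBy, LinearMap.comp_apply, TensorProduct.mk_apply, ← h.mul_act, D₂_mul_σ]
  rw [this, map_smul]

theorem act_σ_one (h : IsModuleAlgebra s act) : actBy act (σ q) 1 = 1 := by
  simp [actBy, h.act_one, counit_σ]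

end Algebra

end Hq

/-- The algebra endomorphism of `S(V)` extending a linear endomorphism of `V`. -/
def SymmetricAlgebra.mapEnd {k V : Type*} [Field k] [AddCommGroup V] [Module k V] (t : V →ₗ[k] V) :
    SymmetricAlgebra k V →ₐ[k] SymmetricAlgebra k V :=
  SymmetricAlgebra.lift (SymmetricAlgebra.ι k V ∘ₗ t)

/-- Linear functionals on `V` extend to characters of the symmetric algebra, and they separate
vectors. -/
theorem SymmetricAlgebra.ι_injective {k V : Type*} [Field k] [AddCommGroup V] [Module k V] :
    Function.Injective (SymmetricAlgebra.ι k V) := by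
  refine (injective_iff_map_eq_zero _).2 fun v hv => by_contra fun hne => ?_
  obtain ⟨ψ, hψ⟩ := Module.Projective.exists_dual_eq_one k hne
  have := SymmetricAlgebra.lift_ι_apply ψ v
  rw [hv, map_zero, hψ] at this
  exact zero_ne_one this

/-! ### Rank-one skew derivations of the crossed product -/

namespace CrossedProduct

variable {k G V : Type*} [Field k] [Group G] [AddCommGroup V] [Module k V]
  {π : Representation k G V} {f : NormalCocycle k G}

theorem monomial_injective (g : G) : Function.Injective (monomial π f g) :=
  Finsupp.single_injective g

/-- The inclusion of `S(V)` in the crossed product. -/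
def ofSym (π : Representation k G V) (f : NormalCocycle k G) :
    SymmetricAlgebra k V →ₐ[k] CrossedProduct π f :=
  AlgHom.ofLinearMap (monomial π f 1) rfl fun P Q => by
    simp [monomial_mul_monomial, f.one_left, symAct_one]

theorem ofSym_apply (P : SymmetricAlgebra k V) : ofSym π f P = monomial π f 1 P := rfl

theorem ofSym_ι (v : V) : ofSym π f (SymmetricAlgebra.ι k V v) = ofV π f v := rfl

theorem ofSym_mul_w (P : SymmetricAlgebra k V) (g : G) :
    ofSym π f P * w π f g = monomial π f g P := by
  simp [ofSym_apply, w, monomial_mul_monomial, f.one_left]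

theorem w_mul_ofSym (P : SymmetricAlgebra k V) (g : G) :
    w π f g * ofSym π f P = monomial π f g (symAct π g P) := by
  simp [ofSym_apply, w, monomial_mul_monomial, f.one_right]

theorem monomial_mul_ofSym (P Q : SymmetricAlgebra k V) (g : G) :
    monomial π f g P * ofSym π f Q = monomial π f g (P * symAct π g Q) := by
  simp [ofSym_apply, monomial_mul_monomial, f.one_right]

theorem ofSym_mul_monomial (P Q : SymmetricAlgebra k V) (g : G) :
    ofSym π f P * monomial π f g Q = monomial π f g (P * Q) := by
  simp [ofSym_apply, monomial_mul_monomial, f.one_left, symAct_one]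

theorem symAct_ι (g : G) (v : V) :
    symAct π g (SymmetricAlgebra.ι k V v) = SymmetricAlgebra.ι k V (π g v) := by
  simp [symAct]

theorem w_mul_ofV (g : G) (v : V) : w π f g * ofV π f v = ofV π f (π g v) * w π f g := by
  rw [← ofSym_ι, ← ofSym_ι, w_mul_ofSym, ofSym_mul_w, symAct_ι]

theorem ofV_mul_comm (u v : V) : ofV π f u * ofV π f v = ofV π f v * ofV π f u := by
  rw [← ofSym_ι, ← ofSym_ι, ← map_mul (ofSym π f), ← map_mul (ofSym π f), mul_comm]

/-- A subset of the crossed product that contains the scalars, `V` and the `w_g`, and is closed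
under addition and multiplication, is everything. -/
theorem mem_of_generators {p : CrossedProduct π f → Prop}
    (scalar : ∀ r : k, p (algebraMap k _ r)) (ofV : ∀ v, p (ofV π f v)) (w : ∀ g, p (w π f g))
    (add : ∀ a b, p a → p b → p (a + b)) (mul : ∀ a b, p a → p b → p (a * b))
    (a : CrossedProduct π f) : p a := by
  induction a using induction_on with
  | zero => simpa using scalar 0
  | add a b ha hb => exact add a b ha hb
  | single g P =>
    rw [← ofSym_mul_w]
    refine mul _ _ ?_ (w g)
    induction P using SymmetricAlgebra.induction with
    | algebraMap r => simpa using scalar r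
    | ι v => exact ofV v
    | mul a b ha hb => rw [map_mul]; exact mul _ _ ha hb
    | add a b ha hb => rw [map_add]; exact add _ _ ha hb

/-- The algebra endomorphism `T` extends `t : V → V` and scales `w_g` by `c g`. -/
structure IsDiagonal (T : CrossedProduct π f →ₐ[k] CrossedProduct π f) (t : V →ₗ[k] V)
    (c : G → kˣ) : Prop where
  map_ofV : ∀ v, T (ofV π f v) = ofV π f (t v)
  map_w : ∀ g, T (w π f g) = (c g : k) • w π f g

namespace IsDiagonal

variable {T : CrossedProduct π f →ₐ[k] CrossedProduct π f} {t : V →ₗ[k] V} {c : G → kˣ}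

theorem map_ofSym (hT : IsDiagonal T t c) (P : SymmetricAlgebra k V) :
    T (ofSym π f P) = ofSym π f (SymmetricAlgebra.mapEnd t P) := by
  induction P using SymmetricAlgebra.induction with
  | algebraMap r => simp
  | ι v => simp [SymmetricAlgebra.mapEnd, ofSym_ι, hT.map_ofV]
  | mul a b ha hb => simp only [map_mul, ha, hb]
  | add a b ha hb => simp only [map_add, ha, hb]

theorem map_monomial (hT : IsDiagonal T t c) (g : G) (P : SymmetricAlgebra k V) :
    T (monomial π f g P) = (c g : k) • monomial π f g (SymmetricAlgebra.mapEnd t P) := by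
  rw [← ofSym_mul_w, map_mul, hT.map_w, hT.map_ofSym, mul_smul_comm, ofSym_mul_w]

end IsDiagonal

/-- Both sides are algebra maps in `P`, so agreement on `U` propagates to the subalgebra generated
by `U`. This is how the hypotheses on `P₁` and `P₂` enter. -/
theorem symAct_mapEnd_eq {U : Submodule k V} {t₁ t₂ : V →ₗ[k] V} {g : G}
    (h : ∀ u ∈ U, π g (t₁ u) = t₂ u) {P : SymmetricAlgebra k V} (hP : P ∈ symSub U) :
    symAct π g (SymmetricAlgebra.mapEnd t₁ P) = SymmetricAlgebra.mapEnd t₂ P := by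
  obtain ⟨Q, rfl⟩ := hP
  let j := SymmetricAlgebra.lift (SymmetricAlgebra.ι k V ∘ₗ U.subtype)
  have : ((symAct π g).comp (SymmetricAlgebra.mapEnd t₁)).comp j =
      (SymmetricAlgebra.mapEnd t₂).comp j := by
    apply SymmetricAlgebra.algHom_ext
    ext u
    simp [j, SymmetricAlgebra.mapEnd, symAct_ι, h u u.2]
  exact DFunLike.congr_fun this Q

/-- `E` is a `(T₁, T₂)`-skew derivation of the crossed product that kills the `w_g` and is
`v ↦ φ v • P w_g` on `V`, with `P ≠ 0`. -/
structure IsRankOneDerivation (T₁ T₂ : CrossedProduct π f →ₐ[k] CrossedProduct π f)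
    (E : CrossedProduct π f →ₗ[k] CrossedProduct π f) (φ : V →ₗ[k] k)
    (P : SymmetricAlgebra k V) (g : G) : Prop where
  leibniz : ∀ a b, E (a * b) = E a * T₁ b + T₂ a * E b
  map_ofV : ∀ v, E (ofV π f v) = φ v • monomial π f g P
  map_w : ∀ h, E (w π f h) = 0
  ne_zero : P ≠ 0

namespace IsRankOneDerivation

variable {T₁ T₂ : CrossedProduct π f →ₐ[k] CrossedProduct π f} {t₁ t₂ : V →ₗ[k] V} {c₁ c₂ : G → kˣ}
  {E : CrossedProduct π f →ₗ[k] CrossedProduct π f} {φ : V →ₗ[k] k} {P : SymmetricAlgebra k V}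
  {g : G}

/-- Obtained by applying `E` to `w_h v = (hv) w_h`; only the terms in which `E` hits a vector
survive. -/
theorem apply_act (hE : IsRankOneDerivation T₁ T₂ E φ P g) (h₁ : IsDiagonal T₁ t₁ c₁)
    (h₂ : IsDiagonal T₂ t₂ c₂) (h : G) (v : V) :
    (φ (π h v) * c₁ h * f.toFun g h) • monomial π f (g * h) P =
      (c₂ h * φ v * f.toFun h g) • monomial π f (h * g) (symAct π h P) := by
  have := congrArg E (w_mul_ofV (f := f) h v)
  rw [hE.leibniz, hE.leibniz, hE.map_w, hE.map_ofV, hE.map_ofV, h₁.map_w, h₂.map_w, zero_mul,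
    zero_add, mul_zero, add_zero, smul_mul_smul_comm, smul_mul_smul_comm, w, monomial_mul_monomial,
    monomial_mul_monomial, smul_smul, smul_smul, one_mul, map_one, mul_one] at this
  exact this.symm

theorem apply_act_eq_zero (hE : IsRankOneDerivation T₁ T₂ E φ P g) (h₁ : IsDiagonal T₁ t₁ c₁)
    (h₂ : IsDiagonal T₂ t₂ c₂) (h : G) {v : V} (hv : φ v = 0) : φ (π h v) = 0 := by
  have := hE.apply_act h₁ h₂ h v
  rw [hv, mul_zero, zero_mul, zero_smul, smul_eq_zero, mul_eq_zero, mul_eq_zero] at this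
  simpa [hE.ne_zero, map_eq_zero_iff _ (monomial_injective (π := π) (f := f) (g * h))] using this

/-- For `h = g` both sides live on the same basis element and carry the same cocycle value `f(g,
g)`, which cancels. -/
theorem apply_act_self (hE : IsRankOneDerivation T₁ T₂ E φ P g) (h₁ : IsDiagonal T₁ t₁ c₁)
    (h₂ : IsDiagonal T₂ t₂ c₂) (v : V) :
    (φ (π g v) * c₁ g) • P = (c₂ g * φ v) • symAct π g P := by
  have := hE.apply_act h₁ h₂ g v
  rw [mul_comm _ (f.toFun g g : k), mul_comm _ (f.toFun g g : k), mul_smul (f.toFun g g : k),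
    mul_smul (f.toFun g g : k)] at this
  have := smul_right_injective _ (f.toFun g g).ne_zero this
  rw [← map_smul (monomial π f _), ← map_smul (monomial π f _)] at this
  exact monomial_injective _ this

/-- Apply `E` to `xu = ux`: the left side gives `P w_g · t₁(u)`, the right side `t₂(u) · P w_g`.
Moving `w_g` to the right and cancelling `P` in the domain `S(V)` leaves the claim. -/
theorem act_eq_of_apply_eq_zero (hE : IsRankOneDerivation T₁ T₂ E φ P g)
    (h₁ : IsDiagonal T₁ t₁ c₁) (h₂ : IsDiagonal T₂ t₂ c₂) {x : V} (hx : φ x = 1) {u : V}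
    (hu : φ u = 0) : π g (t₁ u) = t₂ u := by
  have := congrArg E (ofV_mul_comm (π := π) (f := f) x u)
  simp only [hE.leibniz, hE.map_ofV, h₁.map_ofV, h₂.map_ofV, hx, hu, one_smul, zero_smul,
    mul_zero, add_zero, zero_mul, zero_add] at this
  rw [← ofSym_ι, ← ofSym_ι, monomial_mul_ofSym, ofSym_mul_monomial, symAct_ι, mul_comm] at this
  exact SymmetricAlgebra.ι_injective (mul_right_cancel₀ hE.ne_zero (monomial_injective _ this))

theorem smul_mapEnd (hE : IsRankOneDerivation T₁ T₂ E φ P g)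
    {T : CrossedProduct π f →ₐ[k] CrossedProduct π f} {t : V →ₗ[k] V} {c : G → kˣ}
    (hT : IsDiagonal T t c) {r : k} (hr : ∀ a, T (E a) = r • E (T a)) (v : V) :
    (c g * φ v) • SymmetricAlgebra.mapEnd t P = (r * φ (t v)) • P := by
  have := hr (ofV π f v)
  rw [hT.map_ofV, hE.map_ofV, hE.map_ofV, map_smul, hT.map_monomial, smul_smul, smul_smul,
    ← map_smul (monomial π f g), ← map_smul (monomial π f g), mul_comm] at this
  exact monomial_injective _ this

/-- By `smul_mapEnd` the image of `P` under `t` is a multiple of `P`; comparing the scalars obtained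
from `v` and from `x` shows that `φ ∘ t` is proportional to `φ`. -/
theorem apply_comm (hE : IsRankOneDerivation T₁ T₂ E φ P g)
    {T : CrossedProduct π f →ₐ[k] CrossedProduct π f} {t : V →ₗ[k] V} {c : G → kˣ}
    (hT : IsDiagonal T t c) {r : k} (hr : ∀ a, T (E a) = r • E (T a)) (hr0 : r ≠ 0) {x : V}
    (hx : φ x = 1) (v : V) : φ (t v) = φ (t x) * φ v := by
  have h := hE.smul_mapEnd hT hr v
  rw [mul_comm, mul_smul, ← mul_one (c g : k), ← hx, hE.smul_mapEnd hT hr x, smul_smul] at h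
  have := smul_left_injective k hE.ne_zero h
  exact mul_left_cancel₀ hr0 (by linear_combination -this)

/-- The comparison of eigenvalues of `P` under `T₁`, `T₂` and `g`. -/
theorem eigenvalue_mul (hE : IsRankOneDerivation T₁ T₂ E φ P g)
    (h₁ : IsDiagonal T₁ t₁ c₁) (h₂ : IsDiagonal T₂ t₂ c₂) {r₁ r₂ : k}
    (hr₁ : ∀ a, T₁ (E a) = r₁ • E (T₁ a)) (hr₂ : ∀ a, T₂ (E a) = r₂ • E (T₂ a))
    (hP : P ∈ symSub (LinearMap.ker φ)) {x : V} (hx : φ x = 1) :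
    r₁ * φ (t₁ x) * φ (π g x) = r₂ * φ (t₂ x) := by
  have e1 := congrArg (symAct π g) (hE.smul_mapEnd h₁ hr₁ x)
  have e2 := hE.smul_mapEnd h₂ hr₂ x
  have e3 := hE.apply_act_self h₁ h₂ x
  rw [map_smul, map_smul, symAct_mapEnd_eq (fun u hu => hE.act_eq_of_apply_eq_zero h₁ h₂ hx hu) hP]
    at e1
  simp only [hx, mul_one] at e1 e2 e3
  -- The factor `c₁ g` lets `e3` and `e1` be substituted without division; the factor `c₂ g` that
  -- they introduce is absorbed by `e2`.
  have : (c₁ g * (r₁ * φ (t₁ x) * φ (π g x))) • P = (c₁ g * (r₂ * φ (t₂ x))) • P := by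
    calc _ = (r₁ * φ (t₁ x)) • ((φ (π g x) * c₁ g) • P) := by rw [smul_smul]; ring_nf
      _ = (c₂ g : k) • ((r₁ * φ (t₁ x)) • symAct π g P) := by
        rw [e3, smul_smul, smul_smul, mul_comm]
      _ = (c₁ g : k) • ((c₂ g : k) • SymmetricAlgebra.mapEnd t₂ P) := by
        rw [← e1, smul_smul, smul_smul, mul_comm]
      _ = _ := by rw [e2, smul_smul]
  exact mul_left_cancel₀ (c₁ g).ne_zero (smul_left_injective k hE.ne_zero this)

end IsRankOneDerivation

end CrossedProduct

/-! ### Linear algebra of two hyperplanes -/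

namespace LinearMap

variable {k V : Type*} [Field k] [AddCommGroup V] [Module k V]

theorem exists_functional_of_finrank_quotient_ker_eq_one {M : Type*} [AddCommGroup M] [Module k M]
    {δ : V →ₗ[k] M} (h : Module.finrank k (V ⧸ LinearMap.ker δ) = 1) {x : V}
    (hx : x ∉ LinearMap.ker δ) :
    ∃ φ : V →ₗ[k] k, φ x = 1 ∧ (∀ v, δ v = φ v • δ x) ∧ LinearMap.ker φ = LinearMap.ker δ := by
  obtain ⟨ψ, hψx, hψ⟩ :=
    Submodule.exists_dual_map_eq_bot_of_notMem hx inferInstance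
  replace hψ : ∀ v ∈ ker δ, ψ v = 0 := fun v hv => by
    simpa [hψ] using Submodule.mem_map_of_mem (f := ψ) hv
  have hδ : ∀ v, δ v = ((ψ x)⁻¹ • ψ) v • δ x := by
    intro v
    obtain ⟨c, hc⟩ := (finrank_eq_one_iff_of_nonzero' (Submodule.Quotient.mk (p := ker δ) x)
      (by simpa using hx)).1 h (Submodule.Quotient.mk v)
    rw [← Submodule.Quotient.mk_smul, eq_comm, Submodule.Quotient.eq] at hc
    have h1 := hψ _ hc
    rw [map_sub, map_smul, sub_eq_zero] at h1
    rw [LinearMap.mem_ker, map_sub, map_smul, sub_eq_zero] at hc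
    rw [hc, LinearMap.smul_apply, h1, smul_eq_mul, smul_eq_mul, mul_comm c, inv_mul_cancel_left₀ hψx]
  refine ⟨(ψ x)⁻¹ • ψ, by simp [hψx], hδ, le_antisymm (fun v hv => ?_) fun v hv => ?_⟩
  · rw [LinearMap.mem_ker] at hv ⊢
    rw [hδ, hv, zero_smul]
  · have h1 : ψ v = 0 := hψ v hv
    simp [h1]

/-- If `φ` vanished on `ker ψ`, it would be a nonzero multiple of `ψ`, and the kernels would
coincide. -/
theorem exists_apply_eq_one_of_ker_ne {φ ψ : V →ₗ[k] k} (h : ker φ ≠ ker ψ) {x y : V}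
    (hx : φ x = 1) (hy : ψ y = 1) : ∃ z, ψ z = 0 ∧ φ z = 1 := by
  by_cases hz : ∃ z, ψ z = 0 ∧ φ z ≠ 0
  · obtain ⟨z, h0, h1⟩ := hz
    exact ⟨(φ z)⁻¹ • z, by simp [h0], by simp [h1]⟩
  · push Not at hz
    have key : ∀ v, φ v = ψ v * φ y := fun v => by
      have := hz (v - ψ v • y) (by simp [hy])
      simpa [sub_eq_zero] using this
    have hne : φ y ≠ 0 := fun h0 => by simp [key x, h0] at hx
    refine absurd ?_ h
    ext v
    simp [key v, hne]

/-- The determinant of an endomorphism that fixes `ker φ₁ ∩ ker φ₂` pointwise and has `φ₁`, `φ₂`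
as eigenvectors of its transpose. -/
theorem det_eq_mul_of_fixes_ker_inf_ker [FiniteDimensional k V] {T : V →ₗ[k] V} {φ₁ φ₂ : V →ₗ[k] k}
    {m₁ m₂ : k} (h₁ : ∀ v, φ₁ (T v) = m₁ * φ₁ v) (h₂ : ∀ v, φ₂ (T v) = m₂ * φ₂ v)
    (hT : ∀ v, φ₁ v = 0 → φ₂ v = 0 → T v = v) {y₁ y₂ : V} (h₁₁ : φ₁ y₁ = 1) (h₁₂ : φ₁ y₂ = 0)
    (h₂₁ : φ₂ y₁ = 0) (h₂₂ : φ₂ y₂ = 1) : LinearMap.det T = m₁ * m₂ := by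
  -- Modulo the common kernel, `v` is `φ₁ v • y₁ + φ₂ v • y₂`, so `T` is a product of two rank-one
  -- perturbations of the identity, of determinants `m₁` and `m₂`.
  have : T = transvection φ₁ (T y₁ - y₁) ∘ₗ transvection φ₂ (T y₂ - y₂) := by
    ext v
    have := hT (v - φ₁ v • y₁ - φ₂ v • y₂) (by simp [h₁₁, h₁₂]) (by simp [h₂₁, h₂₂])
    simp only [map_sub, map_smul] at this
    simp only [LinearMap.comp_apply, transvection.apply, map_add, map_smul, map_sub, h₁, h₁₂]
    rw [sub_eq_iff_eq_add, sub_eq_iff_eq_add] at this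
    rw [this]
    simp only [mul_zero]
    module
  rw [this, LinearMap.det_comp, transvection.det, transvection.det, map_sub, map_sub, h₁, h₂, h₁₁,
    h₂₂]
  ring

end LinearMap

/-! ### The eigenvalue identities and the determinant -/

theorem mainTheorem2 {k G V : Type*} [Field k] [Group G] [AddCommGroup V] [Module k V]
    [FiniteDimensional k V]
    (q : kˣ) (π : Representation k G V) (f : NormalCocycle k G)
    -- the good transposition determined by `α̂` and `χ_α`
    (α : V ≃ₗ[k] V) (hα : ∀ (g : G) (v : V), α (π g v) = π g (α v)) (χα : G →* kˣ)
    (s : Hq q ⊗[k] CrossedProduct π f →ₗ[k] CrossedProduct π f ⊗[k] Hq q)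
    (hs : Braided.IsLeftTransposition s) (hgood : Hq.IsGood q s)
    (hsV : ∀ v : V, s (Hq.D₁ q ⊗ₜ CrossedProduct.ofV π f v) =
      CrossedProduct.ofV π f (α v) ⊗ₜ Hq.D₁ q)
    (hsG : ∀ g : G, s (Hq.D₁ q ⊗ₜ CrossedProduct.w π f g) =
      ((χα g : k) • CrossedProduct.w π f g) ⊗ₜ Hq.D₁ q)
    -- the data `δ̂₁`, `δ̂₂`, `ς̂`, `χ_ς`
    (δ₁ δ₂ : V →ₗ[k] CrossedProduct π f) (ς : V →ₗ[k] V) (χς : G → kˣ)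
    (hcodim₁ : Module.finrank k (V ⧸ LinearMap.ker δ₁) = 1)
    (hcodim₂ : Module.finrank k (V ⧸ LinearMap.ker δ₂) = 1)
    (hker : LinearMap.ker δ₁ ≠ LinearMap.ker δ₂)
    (x₁ x₂ : V) (hx₁ : x₁ ∉ LinearMap.ker δ₁) (hx₂ : x₂ ∉ LinearMap.ker δ₂)
    (P₁ P₂ : SymmetricAlgebra k V) (g₁ g₂ : G)
    (hδ₁ : δ₁ x₁ = CrossedProduct.monomial π f g₁ P₁)
    (hδ₂ : δ₂ x₂ = CrossedProduct.monomial π f g₂ P₂)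
    (lam₁ lam₂ : G → k)
    (hlam₁ : ∀ g : G, π g x₁ - lam₁ g • x₁ ∈ LinearMap.ker δ₁)
    (hlam₂ : ∀ g : G, π g x₂ - lam₂ g • x₂ ∈ LinearMap.ker δ₂)
    -- the `H_q`-module algebra structure on `(A, s)`
    (hact : ∃ act : Hq q ⊗[k] CrossedProduct π f →ₗ[k] CrossedProduct π f,
      Braided.IsModuleAlgebra s act ∧
      (∀ v : V, act (Hq.σ q ⊗ₜ CrossedProduct.ofV π f v) = CrossedProduct.ofV π f (ς v)) ∧
      (∀ g : G, act (Hq.σ q ⊗ₜ CrossedProduct.w π f g) =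
        (χς g : k) • CrossedProduct.w π f g) ∧
      (∀ v : V, act (Hq.D₁ q ⊗ₜ CrossedProduct.ofV π f v) = δ₁ v) ∧
      (∀ v : V, act (Hq.D₂ q ⊗ₜ CrossedProduct.ofV π f v) = δ₂ v) ∧
      (∀ g : G, act (Hq.D₁ q ⊗ₜ CrossedProduct.w π f g) = 0) ∧
      (∀ g : G, act (Hq.D₂ q ⊗ₜ CrossedProduct.w π f g) = 0))
    (hP₁ : P₁ ∈ symSub (LinearMap.ker δ₁)) (hP₂ : P₂ ∈ symSub (LinearMap.ker δ₂)) :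
    lam₁ g₁ * lam₁ g₂ = (q : k) ∧
    lam₂ g₁ * lam₂ g₂ = ((q⁻¹ : kˣ) : k) ∧
    LinearMap.det (π (g₁ * g₂)) = 1 := by
  obtain ⟨act, hA, hSV, hSG, hD₁V, hD₂V, hD₁G, hD₂G⟩ := hact
  obtain ⟨φ₁, hφx₁, hφδ₁, hφk₁⟩ :=
    LinearMap.exists_functional_of_finrank_quotient_ker_eq_one hcodim₁ hx₁
  obtain ⟨φ₂, hφx₂, hφδ₂, hφk₂⟩ :=
    LinearMap.exists_functional_of_finrank_quotient_ker_eq_one hcodim₂ hx₂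
  -- The vectors `y₁`, `y₂` form a dual pair for `φ₁`, `φ₂`. They replace `x₁`, `x₂` because each
  -- must also lie in the kernel of the other functional.
  obtain ⟨y₁, h₂₁, h₁₁⟩ := LinearMap.exists_apply_eq_one_of_ker_ne
    (by rwa [hφk₁, hφk₂]) hφx₁ hφx₂
  obtain ⟨y₂, h₁₂, h₂₂⟩ := LinearMap.exists_apply_eq_one_of_ker_ne
    (by rwa [hφk₁, hφk₂, ne_comm]) hφx₂ hφx₁
  have hP₁0 : P₁ ≠ 0 := fun h => hx₁ (by rw [LinearMap.mem_ker, hδ₁, h, map_zero])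
  have hP₂0 : P₂ ≠ 0 := fun h => hx₂ (by rw [LinearMap.mem_ker, hδ₂, h, map_zero])
  rw [← hφk₁] at hP₁ hlam₁
  rw [← hφk₂] at hP₂ hlam₂
  have hD : Hq.D₁ q ≠ 0 := fun h => hx₁ <| by
    rw [LinearMap.mem_ker, ← hD₁V, h, TensorProduct.zero_tmul, map_zero]
  -- The elements `a` with `s(D₁ ⊗ a)` of the form `b ⊗ D₁` are closed under sums and products and
  -- contain the generators, so `α̂` and `χ_α` determine `s` on `D₁`.
  obtain ⟨α', hα'⟩ := Hq.exists_braid_D₁_algHom hs hD <| by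
    refine CrossedProduct.mem_of_generators (fun r => ⟨algebraMap k _ r, ?_⟩)
      (fun v => ⟨_, hsV v⟩) (fun g => ⟨_, hsG g⟩) ?_ ?_
    · rw [Algebra.algebraMap_eq_smul_one, TensorProduct.tmul_smul, map_smul, hs.tmul_one,
        TensorProduct.smul_tmul']
    · rintro a b ⟨a', ha⟩ ⟨b', hb⟩
      exact ⟨a' + b', by rw [TensorProduct.tmul_add, map_add, ha, hb, TensorProduct.add_tmul]⟩
    · rintro a b ⟨a', ha⟩ ⟨b', hb⟩
      exact ⟨a' * b', Hq.braid_D₁_mul hs ha hb⟩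
  have hinj := TensorProduct.tmul_right_injective_of_ne_zero (k := k)
    (M := CrossedProduct π f) hD
  have dα : CrossedProduct.IsDiagonal α' α.toLinearMap χα :=
    ⟨fun v => hinj ((hα' _).symm.trans (hsV v)), fun g => hinj ((hα' _).symm.trans (hsG g))⟩
  have hσ := Hq.braid_σ hs.toIsBraidedSpace hD (α := α'.toLinearMap) hα'
  have hα₂ := Hq.braid_D₂ hs.toIsBraidedSpace hgood hD (α := α'.toLinearMap) hα'
  let S : CrossedProduct π f →ₐ[k] CrossedProduct π f :=
    AlgHom.ofLinearMap (Braided.actBy act (Hq.σ q)) (Hq.act_σ_one hA) (Hq.act_σ_mul hA hσ)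
  have dS : CrossedProduct.IsDiagonal S ς χς := ⟨hSV, hSG⟩
  have hcomm := Hq.act_commute hA hD hα'
  have hq0 : ((q⁻¹ : kˣ) : k) ≠ 0 := Units.ne_zero _
  have hα₁c : ∀ a, α' (Braided.actBy act (Hq.D₁ q) a) =
      (1 : k) • Braided.actBy act (Hq.D₁ q) (α' a) := fun a => by rw [one_smul, hcomm]
  have hS₁c : ∀ a, S (Braided.actBy act (Hq.D₁ q) a) =
      ((q⁻¹ : kˣ) : k) • Braided.actBy act (Hq.D₁ q) (S a) := fun a => by
    change Braided.actBy act (Hq.σ q) _ = _ • Braided.actBy act _ (Braided.actBy act (Hq.σ q) a)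
    rw [Hq.act_σ_D₁ hA, smul_smul, Units.inv_mul, one_smul]
  -- `D₁`, and `D₂` precomposed with `α`, are skew derivations of rank one
  have r₁ : CrossedProduct.IsRankOneDerivation S α' (Braided.actBy act (Hq.D₁ q)) φ₁ P₁ g₁ :=
    ⟨Hq.act_D₁_mul hA hα' hσ, fun v => (hD₁V v).trans (by rw [hφδ₁, hδ₁]), hD₁G, hP₁0⟩
  -- For `D₂ ∘ α'` to be governed by `φ₂` itself, `φ₂ ∘ α` must be proportional to `φ₂`; this is
  -- extracted from the commutation of `α'` with `D₂`.
  have hD₂α : ∀ v, φ₂ (α v) • CrossedProduct.monomial π f g₂ P₂ = (φ₂ v * χα g₂) •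
      CrossedProduct.monomial π f g₂ (SymmetricAlgebra.mapEnd α.toLinearMap P₂) := fun v => by
    have := hcomm (Hq.D₂ q) (CrossedProduct.ofV π f v)
    rw [dα.map_ofV] at this
    change α' (act _) = act _ at this
    rw [TensorProduct.mk_apply, TensorProduct.mk_apply, hD₂V, hD₂V, hφδ₂, hφδ₂ (α.toLinearMap v),
      hδ₂, map_smul, dα.map_monomial, smul_smul] at this
    exact this.symm
  have hφα₂ : ∀ v, φ₂ (α v) = φ₂ v * φ₂ (α x₂) := fun v => by
    have h0 := hD₂α x₂
    have h1 := hD₂α v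
    rw [hφx₂, one_mul] at h0
    rw [mul_smul, ← h0, smul_smul] at h1
    refine smul_left_injective k (fun h => hP₂0 ?_) h1
    exact CrossedProduct.monomial_injective g₂ (h.trans (map_zero _).symm)
  have ha₂ : φ₂ (α x₂) ≠ 0 := fun h => by
    have := hφα₂ (α.symm x₂)
    rw [h, α.apply_symm_apply, hφx₂, mul_zero] at this
    exact one_ne_zero this
  have r₂ : CrossedProduct.IsRankOneDerivation α' S
      (Braided.actBy act (Hq.D₂ q) ∘ₗ α'.toLinearMap) φ₂ (φ₂ (α x₂) • P₂) g₂ := by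
    refine ⟨fun a b => ?_, fun v => ?_, fun g => ?_, smul_ne_zero ha₂ hP₂0⟩
    · simp only [LinearMap.comp_apply, AlgHom.toLinearMap_apply, map_mul]
      exact Hq.act_D₂_mul hA hα₂ a (α' b)
    · rw [LinearMap.comp_apply, AlgHom.toLinearMap_apply, dα.map_ofV]
      refine (hD₂V _).trans ?_
      rw [hφδ₂, hδ₂, map_smul, smul_smul]
      exact congrArg (· • _) (hφα₂ v)
    · rw [LinearMap.comp_apply, AlgHom.toLinearMap_apply, dα.map_w, map_smul]
      exact (congrArg _ (hD₂G g)).trans (smul_zero _)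
  have hα₂c : ∀ a, α' ((Braided.actBy act (Hq.D₂ q) ∘ₗ α'.toLinearMap) a) =
      (1 : k) • (Braided.actBy act (Hq.D₂ q) ∘ₗ α'.toLinearMap) (α' a) := fun a => by
    rw [one_smul, LinearMap.comp_apply, hcomm]; rfl
  have hS₂c : ∀ a, S ((Braided.actBy act (Hq.D₂ q) ∘ₗ α'.toLinearMap) a) =
      ((q⁻¹ : kˣ) : k) • (Braided.actBy act (Hq.D₂ q) ∘ₗ α'.toLinearMap) (S a) := fun a => by
    have : α' (S a) = S (α' a) := hcomm _ a
    rw [LinearMap.comp_apply, LinearMap.comp_apply, AlgHom.toLinearMap_apply,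
      AlgHom.toLinearMap_apply, this]
    change Braided.actBy act (Hq.σ q) _ =
      _ • Braided.actBy act _ (Braided.actBy act (Hq.σ q) (α' a))
    rw [Hq.act_σ_D₂ hA, smul_smul, Units.inv_mul, one_smul]
  have hl₁ : ∀ g v, φ₁ (π g v) = lam₁ g * φ₁ v := fun g v => by
    have h1 := r₁.apply_act_eq_zero dS dα g (v := v - φ₁ v • x₁) (by simp [hφx₁])
    have h2 := hlam₁ g
    simp only [LinearMap.mem_ker, map_sub, map_smul, smul_eq_mul, hφx₁] at h1 h2
    linear_combination h1 + φ₁ v * h2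
  have hl₂ : ∀ g v, φ₂ (π g v) = lam₂ g * φ₂ v := fun g v => by
    have h1 := r₂.apply_act_eq_zero dα dS g (v := v - φ₂ v • x₂) (by simp [hφx₂])
    have h2 := hlam₂ g
    simp only [LinearMap.mem_ker, map_sub, map_smul, smul_eq_mul, hφx₂] at h1 h2
    linear_combination h1 + φ₂ v * h2
  have hφα₁ : ∀ v, φ₁ (α v) = φ₁ (α y₁) * φ₁ v := r₁.apply_comm dα hα₁c one_ne_zero h₁₁
  have ha₁ : φ₁ (α y₁) ≠ 0 := fun h => by
    have := hφα₁ (α.symm x₁)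
    rw [h, α.apply_symm_apply, hφx₁, zero_mul] at this
    exact one_ne_zero this
  have f₁ : ∀ u, φ₁ u = 0 → π g₁ (ς u) = α u := fun u =>
    r₁.act_eq_of_apply_eq_zero dS dα h₁₁
  have f₂ : ∀ u, φ₂ u = 0 → π g₂ (α u) = ς u := fun u =>
    r₂.act_eq_of_apply_eq_zero dα dS h₂₂
  have e₁ : ((q⁻¹ : kˣ) : k) * φ₁ (ς y₁) * φ₁ (π g₁ y₁) = 1 * φ₁ (α y₁) :=
    r₁.eigenvalue_mul dS dα hS₁c hα₁c hP₁ h₁₁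
  have e₂ : 1 * φ₂ (α y₂) * φ₂ (π g₂ y₂) = ((q⁻¹ : kˣ) : k) * φ₂ (ς y₂) :=
    r₂.eigenvalue_mul dα dS hα₂c hS₂c ((symSub _).smul_mem hP₂ _) h₂₂
  -- As `y₁ ∈ ker φ₂`, `ς y₁` equals `g₂ α y₁`, which brings in the eigenvalue at `g₂`; then `φ₁ (α
  -- y₁)` cancels. Symmetrically, `y₂ ∈ ker φ₁` gives `α y₂ = g₁ ς y₂`, and `φ₂ (ς y₂)` cancels.
  rw [← f₂ y₁ h₂₁, hl₁, hl₁, h₁₁] at e₁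
  have e₃ := congrArg φ₂ (f₁ y₂ h₁₂)
  rw [hl₂] at e₃
  rw [hl₂, h₂₂, ← e₃] at e₂
  have hς : φ₂ (ς y₂) ≠ 0 := fun h => by
    rw [h, mul_zero, hφα₂, h₂₂, one_mul] at e₃
    exact ha₂ e₃.symm
  have m₁ : lam₁ g₁ * lam₁ g₂ = (q : k) := by
    have h1 : ((q⁻¹ : kˣ) : k) * (lam₁ g₁ * lam₁ g₂) = 1 :=
      mul_right_cancel₀ ha₁ (by linear_combination e₁)
    rw [← Units.mul_inv_cancel_left q (lam₁ g₁ * lam₁ g₂), h1, mul_one]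
  have m₂ : lam₂ g₁ * lam₂ g₂ = ((q⁻¹ : kˣ) : k) :=
    mul_right_cancel₀ hς (by linear_combination e₂)
  refine ⟨m₁, m₂, ?_⟩
  rw [LinearMap.det_eq_mul_of_fixes_ker_inf_ker (T := π (g₁ * g₂)) (φ₁ := φ₁) (φ₂ := φ₂)
    (m₁ := q) (m₂ := ((q⁻¹ : kˣ) : k)) (fun v => ?_) (fun v => ?_) (fun v hv₁ hv₂ => ?_)
    h₁₁ h₁₂ h₂₁ h₂₂, Units.mul_inv]
  · rw [map_mul, Module.End.mul_apply, hl₁, hl₁, ← m₁, mul_assoc]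
  · rw [map_mul, Module.End.mul_apply, hl₂, hl₂, ← m₂, mul_assoc]
  -- Since `α` preserves both kernels, `u` lies in their intersection as well, and `g₂` sends `α u`
  -- to `ς u`, which `g₁` sends back to `α u`.
  · obtain ⟨u, rfl⟩ := α.surjective v
    rw [hφα₁] at hv₁
    rw [hφα₂] at hv₂
    rw [map_mul, Module.End.mul_apply, f₂ u ((mul_eq_zero.1 hv₂).resolve_right ha₂),
      f₁ u ((mul_eq_zero.1 hv₁).resolve_left ha₁)]

end
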